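/- **Setting.** Consider a $K$-user MIMO interference network: transmitter $i$ has $N_i$ antennas, receiver $j$ has $M_j$ antennas, and $d_i\ge 1$ data streams are sent from transmitter $i$ to receiver $i$. The fading matrices $\mathbf H_{ji}\in\mathbb C^{M_j\times N_i}$ ($1\le i,j\le K$) have i.i.d. circularly symmetric complex Gaussian entries with zero mean and unit variance. A *feedback profile* $\mathcal L$ consists of integers $0\le M_j^s\le M_j$, $0\le N_i^s\le N_i$ and, for each receiver $j$, a partition of $\{1,\dots,K\}\setminus\{j\}$ into four (possibly empty) sets $\Omega_j^{I},\Omega_j^{II},\Omega_j^{III},\Omega_j^{IV}$. Let $\mathbf H_{ji}^s$ be the upper left $M_j^s\times N_i^s$ submatrix of $\mathbf H_{ji}$, and put $$M_j^e=M_j^s-\sum_{i\in\Omega_j^{II}}N_i^s,\qquad N_i^e=N_i^s-\sum_{j:\,i\in\Omega_j^{III}}M_j^e,\qquad d_j^0=d_j+\sum_{i\in\Omega_j^{I}}d_i .$$ Let $\mathbf S_j^r\in\mathbb C^{M_j^s\times M_j^e}$ have orthonormal columns spanning the left null space $\{\mathbf u:\mathbf u^\dagger\mathbf A=\mathbf 0\}$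 of the block row $\mathbf A=[\cdots\ \mathbf H_{ji}^s\ \cdots]_{i\in\Omega_j^{II}}$, and let $\mathbf S_i^t\in\mathbb C^{N_i^s\times N_i^e}$ have orthonormal columns spanning $\bigcap_{j:\,i\in\Omega_j^{III}}\{\mathbf u:(\mathbf S_j^r)^\dagger\mathbf H_{ji}^s\mathbf u=\mathbf 0\}$. Receiver $j$ feeds back to all transmitters the null space of $(\mathbf S_j^r)^\dagger\mathbf H_{jp}^s$ for each $p\in\Omega_j^{III}$, and the row space $\mathrm{span}\big([\cdots\ (\mathbf S_j^r)^\dagger\mathbf H_{jq}^s\ \cdots]_{q\in\Omega_j^{IV}}^T\big)$; these do not depend on the choice of $\mathbf S_j^r$. **The problem.** The interference alignment problem with partial CSI is *feasible* under $\mathcal L$ if there are precoders $\mathbf V_i\in\mathbb C^{N_i\times d_i}$ which are functions of the fed back subspaces only such that, on an event of positive probability (in particular, if this holds almost surely), there are decorrelators $\mathbf U_j\in\mathbb C^{M_j\times d_j}$ (which may depend on the channel realization), matrices $\mathbf V_i^a\in\mathbb C^{N_i^e\times d_i}$, $\mathbf U_j^a\in\mathbb C^{M_j^e\times d_j}$ and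 invertible $\mathbf R_j\in\mathbb C^{M_j^e\times M_j^e}$ with $$\mathbf V_i=\begin{bmatrix}\mathbf S_i^t\mathbf V_i^a\\ \mathbf 0\end{bmatrix},\qquad \mathbf U_j=\begin{bmatrix}\mathbf S_j^r\mathbf R_j^\dagger\mathbf U_j^a\\ \mathbf 0\end{bmatrix},$$ $$\operatorname{rank}(\mathbf U_j^\dagger\mathbf H_{jj}\mathbf V_j)=d_j\ \ \forall j,\qquad \mathbf U_j^\dagger\mathbf H_{ji}\mathbf V_i=\mathbf 0\ \ \forall i\ne j .$$ **Theorem (Necessary Feasibility Conditions).** If the problem is feasible under $\mathcal L$, then 1. $N_i^e\ge d_i$ for all $i$; 2. $M_j^e\ge d_j^0$ for all $j$; 3. with $V_i=d_i(N_i^e-d_i)$, $U_j=d_j^0(M_j^e-d_j^0)$ and $C_{ji}=d_j^0d_i$, for every subset $\Omega_{sub}\subseteq\{(j,i): i\in\Omega_j^{IV}\}$, $$\sum_{j:\ \exists i,\,(j,i)\in\Omega_{sub}}U_j+\sum_{i:\ \exists j,\,(j,i)\in\Omega_{sub}}V_i\ \ge\sum_{(j,i)\in\Omega_{sub}}C_{ji}.$$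 -/

import Mathlib

open MeasureTheory ProbabilityTheory Matrix
open scoped NNReal ENNReal

noncomputable section

namespace InterferenceAlignment

/-! ### Network, channels, and their law -/

/-- A `K`-user MIMO interference network: transmitter `i` has `N i` antennas, receiver `j` has
`M j` antennas, and `d i` data streams are sent from transmitter `i` to receiver `i`. -/
structure Network (K : ℕ) where
  M : Fin K → ℕ
  N : Fin K → ℕ
  d : Fin K → ℕ

/-- A channel realization: `H j i` lists the entries of the `M j × N i` fading matrix from
transmitter `i` to receiver `j`. -/
abbrev Network.Channels {K : ℕ} (W : Network K) : Type :=
  ∀ j i : Fin K, Fin (W.M j) → Fin (W.N i) → ℂ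

/-- The fading matrix `H_ji` from transmitter `i` to receiver `j`. -/
def Network.fading {K : ℕ} (W : Network K) (H : W.Channels) (j i : Fin K) :
    Matrix (Fin (W.M j)) (Fin (W.N i)) ℂ :=
  Matrix.of (H j i)

/-- The circularly symmetric complex Gaussian law with mean zero and unit variance: the real and
imaginary parts are independent real Gaussians of mean zero and variance `1 / 2`. -/
def complexGaussian : Measure ℂ :=
  Measure.map (fun p : ℝ × ℝ => (⟨p.1, p.2⟩ : ℂ))
    ((gaussianReal 0 (1 / 2)).prod (gaussianReal 0 (1 / 2)))

/-- The law of the channels: all entries of all fading matrices are i.i.d. standard complex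
Gaussian. -/
def Network.channelLaw {K : ℕ} (W : Network K) : Measure W.Channels :=
  Measure.pi fun j => Measure.pi fun i =>
    Measure.pi fun _ : Fin (W.M j) => Measure.pi fun _ : Fin (W.N i) => complexGaussian

/-! ### Linear algebra -/

/-- The column space of a matrix. -/
def colSpace {m n : Type*} [Fintype n] (A : Matrix m n ℂ) : Submodule ℂ (m → ℂ) :=
  LinearMap.range A.mulVecLin

/-- The null space `{u | A u = 0}`. -/
def nullSpace {m n : Type*} [Fintype n] (A : Matrix m n ℂ) : Submodule ℂ (n → ℂ) :=
  LinearMap.ker A.mulVecLin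

/-- The left null space `{u | u† A = 0}`, written as `{u | A† u = 0}`. -/
def leftNullSpace {m n : Type*} [Fintype m] (A : Matrix m n ℂ) : Submodule ℂ (m → ℂ) :=
  LinearMap.ker Aᴴ.mulVecLin

/-- The matrix `[⋯ A i ⋯]` obtained by putting the blocks `A i`, `i ∈ s`, side by side. -/
def blockRow {ι m : Type*} {n : ι → ℕ} (s : Finset ι) (A : ∀ i, Matrix m (Fin (n i)) ℂ) :
    Matrix m ((i : s) × Fin (n i)) ℂ :=
  Matrix.of fun r c => A c.1 r c.2

/-- The matrix `[A; 0]` with `n` rows. -/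
def padRows {m : ℕ} {κ : Type*} (n : ℕ) (A : Matrix (Fin m) κ ℂ) : Matrix (Fin n) κ ℂ :=
  Matrix.of fun r c => if h : (r : ℕ) < m then A ⟨r, h⟩ c else 0

/-! ### Feedback profiles -/

/-- The four feedback strategies. -/
inductive Strategy
  | I
  | II
  | III
  | IV

/-- A feedback profile: sizes of the channel submatrices, and for every receiver `j` a partition
of its cross links `{i | i ≠ j}` into four sets `Ω m j`. -/
structure FeedbackProfile {K : ℕ} (W : Network K) where
  Ms : Fin K → ℕ
  Ns : Fin K → ℕ
  Ms_le : ∀ j, Ms j ≤ W.M j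
  Ns_le : ∀ i, Ns i ≤ W.N i
  Ω : Strategy → Fin K → Finset (Fin K)
  disjoint : ∀ j m n, m ≠ n → Disjoint (Ω m j) (Ω n j)
  cover : ∀ j i, (∃ m, i ∈ Ω m j) ↔ i ≠ j

namespace FeedbackProfile

variable {K : ℕ} {W : Network K} (L : FeedbackProfile W)

/-- `M_j^e = M_j^s - ∑_{i ∈ Ω_j^II} N_i^s`, as an integer. -/
def Me (j : Fin K) : ℤ := (L.Ms j : ℤ) - ∑ i ∈ L.Ω .II j, (L.Ns i : ℤ)

/-- `N_i^e = N_i^s - ∑_{j : i ∈ Ω_j^III} M_j^e`, as an integer. -/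
def Ne (i : Fin K) : ℤ := (L.Ns i : ℤ) - ∑ j with i ∈ L.Ω .III j, L.Me j

/-- `d_j^0 = d_j + ∑_{i ∈ Ω_j^I} d_i`. -/
def d0 (j : Fin K) : ℕ := W.d j + ∑ i ∈ L.Ω .I j, W.d i

/-- The upper left `M_j^s × N_i^s` submatrix of `H_ji`. -/
def sub (H : W.Channels) (j i : Fin K) : Matrix (Fin (L.Ms j)) (Fin (L.Ns i)) ℂ :=
  (W.fading H j i).submatrix (Fin.castLE (L.Ms_le j)) (Fin.castLE (L.Ns_le i))

/-- `S` is an admissible family of receive filters `S_j^r` at the realization `H`. -/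
def IsReceiveFilter (H : W.Channels)
    (S : ∀ j, Matrix (Fin (L.Ms j)) (Fin (L.Me j).toNat) ℂ) : Prop :=
  ∀ j, (S j)ᴴ * S j = 1 ∧
    colSpace (S j) = leftNullSpace (blockRow (L.Ω .II j) (L.sub H j))

/-- What the transmitters receive: from every receiver `j`, a subspace of `ℂ^{N_p^s}` for each
`p ∈ Ω_j^III`, and one subspace of `⨁_{q ∈ Ω_j^IV} ℂ^{N_q^s}`. -/
abbrev Feedback : Type :=
  ∀ j : Fin K, (∀ p : L.Ω .III j, Submodule ℂ (Fin (L.Ns p) → ℂ)) ×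
    Submodule ℂ ((q : L.Ω .IV j) × Fin (L.Ns q) → ℂ)

/-- The feedback functions: null spaces of `(S_j^r)† H_jp^s` for `p ∈ Ω_j^III`, and the row
space of `[⋯ (S_j^r)† H_jq^s ⋯]_{q ∈ Ω_j^IV}`. They do not depend on the choice of the admissible
family `S`, see `feedback_unique`. -/
def feedback (H : W.Channels) (S : ∀ j, Matrix (Fin (L.Ms j)) (Fin (L.Me j).toNat) ℂ) :
    L.Feedback :=
  fun j => (fun p => nullSpace ((S j)ᴴ * L.sub H j p),
    colSpace (blockRow (L.Ω .IV j) fun q => (S j)ᴴ * L.sub H j q)ᵀ)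

/-- The feedback does not depend on the choice of the admissible receive filters. -/
theorem feedback_unique (H : W.Channels)
    {S S' : ∀ j, Matrix (Fin (L.Ms j)) (Fin (L.Me j).toNat) ℂ}
    (hS : L.IsReceiveFilter H S) (hS' : L.IsReceiveFilter H S') :
    L.feedback H S = L.feedback H S' := by
  have key : ∀ {S S' : ∀ j, Matrix (Fin (L.Ms j)) (Fin (L.Me j).toNat) ℂ},
      L.IsReceiveFilter H S → L.IsReceiveFilter H S' → ∀ j,
        ∃ Q : Matrix (Fin (L.Me j).toNat) (Fin (L.Me j).toNat) ℂ, S' j = S j * Q := by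
    intro S S' hS hS' j
    have h : ∀ c, ∃ x, S j *ᵥ x = (S' j).col c := by
      intro c
      have hc : (S' j).col c ∈ colSpace (S j) := by
        rw [(hS j).2, ← (hS' j).2]
        exact ⟨Pi.single c 1, by simp⟩
      exact hc
    choose x hx using h
    refine ⟨(Matrix.of x)ᵀ, ?_⟩
    ext r c
    have := congrFun (hx c) r
    simpa [Matrix.mul_apply, Matrix.mulVec, dotProduct] using this.symm
  have hnull : ∀ {S S' : ∀ j, Matrix (Fin (L.Ms j)) (Fin (L.Me j).toNat) ℂ},
      L.IsReceiveFilter H S → L.IsReceiveFilter H S' → ∀ j p,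
        nullSpace ((S j)ᴴ * L.sub H j p) ≤ nullSpace ((S' j)ᴴ * L.sub H j p) := by
    intro S S' hS hS' j p u hu
    obtain ⟨Q, hQ⟩ := key hS hS' j
    have hu' : ((S j)ᴴ * L.sub H j p) *ᵥ u = 0 := hu
    change ((S' j)ᴴ * L.sub H j p) *ᵥ u = 0
    rw [hQ, Matrix.conjTranspose_mul, Matrix.mul_assoc, ← Matrix.mulVec_mulVec, hu',
      Matrix.mulVec_zero]
  have hrow : ∀ {S S' : ∀ j, Matrix (Fin (L.Ms j)) (Fin (L.Me j).toNat) ℂ},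
      L.IsReceiveFilter H S → L.IsReceiveFilter H S' → ∀ j,
        colSpace (blockRow (L.Ω .IV j) fun q => (S' j)ᴴ * L.sub H j q)ᵀ ≤
          colSpace (blockRow (L.Ω .IV j) fun q => (S j)ᴴ * L.sub H j q)ᵀ := by
    rintro S S' hS hS' j _ ⟨x, rfl⟩
    obtain ⟨Q, hQ⟩ := key hS hS' j
    refine ⟨(Qᴴ)ᵀ *ᵥ x, ?_⟩
    have : (blockRow (L.Ω .IV j) fun q => (S' j)ᴴ * L.sub H j q) =
        Qᴴ * blockRow (L.Ω .IV j) fun q => (S j)ᴴ * L.sub H j q := by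
      ext r c
      simp only [blockRow, hQ, Matrix.conjTranspose_mul, Matrix.mul_assoc, Matrix.of_apply]
      rw [Matrix.mul_apply, Matrix.mul_apply]
      rfl
    simp only [Matrix.mulVecLin_apply, Matrix.mulVec_mulVec]
    rw [this, Matrix.transpose_mul]
  funext j
  refine Prod.ext (funext fun p => ?_) ?_
  · exact le_antisymm (hnull hS hS' j p) (hnull hS' hS j p)
  · exact le_antisymm (hrow hS' hS j) (hrow hS hS' j)

/-- `T` is an admissible family of transmit filters `S_i^t`, given the receive filters `S`. -/
def IsTransmitFilter (H : W.Channels)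
    (S : ∀ j, Matrix (Fin (L.Ms j)) (Fin (L.Me j).toNat) ℂ)
    (T : ∀ i, Matrix (Fin (L.Ns i)) (Fin (L.Ne i).toNat) ℂ) : Prop :=
  ∀ i, (T i)ᴴ * T i = 1 ∧
    colSpace (T i) = ⨅ j, ⨅ _ : i ∈ L.Ω .III j, nullSpace ((S j)ᴴ * L.sub H j i)

end FeedbackProfile

/-! ### The interference alignment problem -/

/-- The interference alignment conditions at the realization `H`. -/
def IsAligned {K : ℕ} (W : Network K) (H : W.Channels)
    (V : ∀ i, Matrix (Fin (W.N i)) (Fin (W.d i)) ℂ)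
    (U : ∀ j, Matrix (Fin (W.M j)) (Fin (W.d j)) ℂ) : Prop :=
  (∀ j, ((U j)ᴴ * W.fading H j j * V j).rank = W.d j) ∧
    ∀ i j, i ≠ j → (U j)ᴴ * W.fading H j i * V i = 0

namespace FeedbackProfile

variable {K : ℕ} {W : Network K} (L : FeedbackProfile W)

/-- The precoding maps `v`, which see only the feedback, solve the alignment problem at the
realization `H` together with suitable decorrelators, the solution having the structure
`V_i = [S_i^t V_i^a; 0]`, `U_j = [S_j^r R_j† U_j^a; 0]`. -/
def SolvesAt (v : ∀ i, L.Feedback → Matrix (Fin (W.N i)) (Fin (W.d i)) ℂ)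
    (H : W.Channels) : Prop :=
  ∃ (S : ∀ j, Matrix (Fin (L.Ms j)) (Fin (L.Me j).toNat) ℂ)
    (T : ∀ i, Matrix (Fin (L.Ns i)) (Fin (L.Ne i).toNat) ℂ)
    (R : ∀ j, Matrix (Fin (L.Me j).toNat) (Fin (L.Me j).toNat) ℂ)
    (Va : ∀ i, Matrix (Fin (L.Ne i).toNat) (Fin (W.d i)) ℂ)
    (Ua : ∀ j, Matrix (Fin (L.Me j).toNat) (Fin (W.d j)) ℂ),
    L.IsReceiveFilter H S ∧ L.IsTransmitFilter H S T ∧ (∀ j, IsUnit (R j)) ∧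
    (∀ i, v i (L.feedback H S) = padRows (W.N i) (T i * Va i)) ∧
    IsAligned W H (fun i => v i (L.feedback H S))
      (fun j => padRows (W.M j) (S j * (R j)ᴴ * Ua j))

/-- The alignment problem with partial channel knowledge is feasible: some precoding maps, which
see only the feedback, solve it on an event of positive probability. -/
def Feasible : Prop :=
  ∃ v : ∀ i, L.Feedback → Matrix (Fin (W.N i)) (Fin (W.d i)) ℂ,
    ∃ A : Set W.Channels, MeasurableSet A ∧ 0 < W.channelLaw A ∧ ∀ H ∈ A, L.SolvesAt v H

/-- `V_i = d_i (N_i^e - d_i)`. -/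
def freeV (i : Fin K) : ℤ := W.d i * (L.Ne i - W.d i)

/-- `U_j = d_j^0 (M_j^e - d_j^0)`. -/
def freeU (j : Fin K) : ℤ := L.d0 j * (L.Me j - L.d0 j)

/-- `C_ji = d_j^0 d_i`. -/
def constraints (j i : Fin K) : ℤ := L.d0 j * W.d i

/-- The links treated by strategy IV, as pairs `(j, i)` of receiver and transmitter. -/
def linksIV : Finset (Fin K × Fin K) :=
  Finset.univ.filter fun p => p.2 ∈ L.Ω .IV p.1

end FeedbackProfile

end InterferenceAlignment

end

/-!
The proof is a dimension count, made rigorous by the lemma of Sard in its easy form, and preceded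
by two conditioning steps.

*Count.* Let `A j` and `B i` be unknown matrices of full rank `a j` and `b i`, subject to
`A j * G * B i = 0` with one coefficient matrix `G` for each link. Only the row space of `A j` and
the column space of `B i` matter, so both can be normalized to contain an identity block; then a
block of `a j * b i` entries of each `G` is a polynomial function of the remaining entries and of
the free entries of `A` and `B`. Hence the solvable systems lie in finitely many images of
differentiable maps, from a space whose dimension falls short of that of the space of coefficients
by the number of scalar equations minus the number of free variables. If that difference is
positive, they form a null set (`volume_solvable_eq_zero`). The channel law is absolutely
continuous and the filters have full rank, so the same holds for channels seen through fixed
filters (`sum_le_of_channelLaw_pos`).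

*Strategy I links.* Neither the filters nor the feedback depend on them. Fixing all other links
fixes the filters, the precoders and, at receiver `j`, the space `E j` of decorrelator rows that
cancel the interference from the strategy IV links. The count for a single receiver, with fixed
precoders and decorrelators in `E j`, reads `d j * ∑ d i ≤ d j * (dim E j - d j)`, the sum being
over the strategy I links; that is, `d0 j ≤ dim E j`. So there are even `d0 j` independent rows that
cancel the strategy IV interference (`FeedbackProfile.hasRoom_of_mem_resampleSet`). The first two
inequalities follow by comparing ranks with matrix sizes.

*Strategy IV links.* The filters do not depend on them either. Fixing all other links fixes the
filters, and the count for the links in the given subset, with `d0 j` rows at receiver `j` and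
`d i` columns at transmitter `i`, is the third inequality.

Conditioning is expressed by resampling: replacing some of the links by those of an independent copy
of the channels preserves the law (`Network.measurePreserving_resample`), so an event of positive
probability is reached with positive probability by resampling from a fixed realization.
-/

namespace InterferenceAlignment

/-! ### Null sets and resampling for product measures -/

theorem pi_absolutelyContinuous {n : ℕ} {α : Fin n → Type*} [∀ i, MeasurableSpace (α i)]
    (μ ν : ∀ i, Measure (α i)) [∀ i, SigmaFinite (μ i)] [∀ i, SigmaFinite (ν i)]
    (h : ∀ i, μ i ≪ ν i) : Measure.pi μ ≪ Measure.pi ν := by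
  induction n with
  | zero => rw [Measure.pi_of_empty μ, Measure.pi_of_empty ν]
  | succ n ih =>
    have h1 := measurePreserving_piFinSuccAbove μ 0
    have h2 := measurePreserving_piFinSuccAbove ν 0
    rw [← h1.symm.map_eq, ← h2.symm.map_eq]
    exact ((h 0).prod (ih _ _ fun i => h _)).map (MeasurableEquiv.measurable _)

/-- Pairing the coordinates of two independent samples of a product measure gives a sample of the
product of the squares. -/
theorem measurePreserving_pi_prod {ι : Type*} [Fintype ι] {α : ι → Type*}
    [∀ i, MeasurableSpace (α i)] (μ : ∀ i, Measure (α i)) [∀ i, SigmaFinite (μ i)] :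
    MeasurePreserving
      (fun p : (∀ i, α i) × (∀ i, α i) => fun i => (p.1 i, p.2 i))
      ((Measure.pi μ).prod (Measure.pi μ)) (Measure.pi fun i => (μ i).prod (μ i)) := by
  classical
  have hm : Measurable (fun p : (∀ i, α i) × (∀ i, α i) => fun i => (p.1 i, p.2 i)) := by
    fun_prop
  refine ⟨hm, ?_⟩
  refine (Measure.pi_eq_generateFrom (C := fun i => Set.image2 (· ×ˢ ·)
    {s : Set (α i) | MeasurableSet s} {s : Set (α i) | MeasurableSet s})
    (fun i => generateFrom_prod) (fun i => isPiSystem_prod)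
    (fun i => (μ i).toFiniteSpanningSetsIn.prod (μ i).toFiniteSpanningSetsIn) ?_).symm
  intro s hs
  choose a ha b hb hab using hs
  obtain rfl : s = fun i => a i ×ˢ b i := funext fun i => (hab i).symm
  rw [Measure.map_apply hm (MeasurableSet.univ_pi fun i => (ha i).prod (hb i))]
  rw [show (fun p : (∀ i, α i) × (∀ i, α i) => fun i => (p.1 i, p.2 i)) ⁻¹'
      (Set.univ.pi fun i => a i ×ˢ b i) = Set.univ.pi a ×ˢ Set.univ.pi b by
        ext; simp [Set.mem_pi, forall_and]]
  simp_rw [Measure.prod_prod, Measure.pi_pi, Finset.prod_mul_distrib]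

/-- Combining two independent samples of a product measure coordinate by coordinate. -/
theorem measurePreserving_pi_combine {ι : Type*} [Fintype ι] {α : ι → Type*}
    [∀ i, MeasurableSpace (α i)] (μ : ∀ i, Measure (α i)) [∀ i, SigmaFinite (μ i)]
    {f : ∀ i, α i × α i → α i} (hf : ∀ i, MeasurePreserving (f i) ((μ i).prod (μ i)) (μ i)) :
    MeasurePreserving (fun p : (∀ i, α i) × (∀ i, α i) => fun i => f i (p.1 i, p.2 i))
      ((Measure.pi μ).prod (Measure.pi μ)) (Measure.pi μ) :=
  (measurePreserving_pi (fun i => (μ i).prod (μ i)) μ hf).comp (measurePreserving_pi_prod μ)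

/-- A differentiable map into a space of larger dimension has a null range. -/
theorem addHaar_range_eq_zero_of_finrank_lt {E F : Type*} [NormedAddCommGroup E] [NormedSpace ℝ E]
    [FiniteDimensional ℝ E] [NormedAddCommGroup F] [NormedSpace ℝ F] [FiniteDimensional ℝ F]
    [MeasurableSpace F] [BorelSpace F] (μ : Measure F) [μ.IsAddHaarMeasure]
    {f : E → F} (hf : Differentiable ℝ f) (h : Module.finrank ℝ E < Module.finrank ℝ F) :
    μ (Set.range f) = 0 := by
  -- A linear surjection `F → E` has a nontrivial kernel, so `f` composed with it is a self-map
  -- of `F` whose derivative is nowhere invertible.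
  obtain ⟨g, hg⟩ : ∃ g : E →ₗ[ℝ] F, Function.Injective g := by
    refine Module.Free.exists_linearMap_injective_of_lift_rank_lt ?_
    rw [← Module.finrank_eq_rank, ← Module.finrank_eq_rank]
    simpa only [Cardinal.lift_natCast, Nat.cast_lt] using h
  obtain ⟨L, hL⟩ := g.exists_leftInverse_of_injective (LinearMap.ker_eq_bot.2 hg)
  have hLs : Function.Surjective L := fun x => ⟨g x, LinearMap.congr_fun hL x⟩
  have hrange : Set.range f = (f ∘ L) '' Set.univ := by
    rw [Set.image_univ, hLs.range_comp]
  rw [hrange]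
  refine MeasureTheory.addHaar_image_eq_zero_of_det_fderivWithin_eq_zero μ
    (f' := fun x => (fderiv ℝ f (L x)).comp L.toContinuousLinearMap) (fun x _ => ?_) fun x _ => ?_
  · exact ((hf (L x)).hasFDerivAt.comp x
      L.toContinuousLinearMap.hasFDerivAt).hasFDerivWithinAt
  · by_contra hdet
    have hinj : Function.Injective ((fderiv ℝ f (L x)).comp L.toContinuousLinearMap : F →ₗ[ℝ] F) :=
      (LinearMap.equivOfDetNeZero _ hdet).injective
    have : Function.Injective L := fun a b hab => hinj (by simp [hab])
    exact absurd (LinearMap.finrank_le_finrank_of_injective this) (not_le.2 h)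

/-- The preimage of a null set under a linear surjection is null. -/
theorem addHaar_preimage_eq_zero {E F : Type*} [NormedAddCommGroup E] [NormedSpace ℝ E]
    [MeasurableSpace E] [BorelSpace E] [FiniteDimensional ℝ E]
    [NormedAddCommGroup F] [NormedSpace ℝ F] [FiniteDimensional ℝ F]
    [MeasurableSpace F] [BorelSpace F] (μ : Measure E) [μ.IsAddHaarMeasure]
    (ν : Measure F) [ν.IsAddHaarMeasure] (L : E →ₗ[ℝ] F) (hL : Function.Surjective L)
    {s : Set F} (hs : ν s = 0) : μ (L ⁻¹' s) = 0 := by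
  obtain ⟨c, -, hc⟩ := L.exists_map_addHaar_eq_smul_addHaar μ ν hL
  have hq : Measure.QuasiMeasurePreserving L μ ν :=
    ⟨L.continuous_of_finiteDimensional.measurable, by
      rw [hc]; exact Measure.smul_absolutelyContinuous⟩
  exact hq.preimage_null hs

theorem isAddHaarMeasure_volume_matrix (m n : ℕ) :
    (volume : Measure (Fin m → Fin n → ℂ)).IsAddHaarMeasure := Measure.pi.isAddHaarMeasure _

theorem isAddHaarMeasure_volume_matrices {Λ : Type*} [Fintype Λ] (m n : Λ → ℕ) :
    (volume : Measure (∀ l, Fin (m l) → Fin (n l) → ℂ)).IsAddHaarMeasure := by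
  have := fun l => isAddHaarMeasure_volume_matrix (m l) (n l)
  exact Measure.pi.isAddHaarMeasure _

theorem isAddHaarMeasure_volume_channels {K : ℕ} (W : Network K) :
    (volume : Measure W.Channels).IsAddHaarMeasure := by
  have := fun j => isAddHaarMeasure_volume_matrices (fun _ => W.M j) W.N
  exact Measure.pi.isAddHaarMeasure _

instance : IsProbabilityMeasure complexGaussian :=
  Measure.isProbabilityMeasure_map Complex.measurableEquivRealProd.symm.measurable.aemeasurable

theorem complexGaussian_absolutelyContinuous : complexGaussian ≪ volume := by
  have h : gaussianReal 0 (1 / 2) ≪ volume := gaussianReal_absolutelyContinuous _ (by norm_num)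
  rw [← Complex.volume_preserving_equiv_real_prod.symm.map_eq]
  exact (h.prod h).map Complex.measurableEquivRealProd.symm.measurable

namespace Network

variable {K : ℕ} (W : Network K)

instance : IsProbabilityMeasure W.channelLaw := by
  unfold channelLaw; infer_instance

theorem channelLaw_absolutelyContinuous : W.channelLaw ≪ volume :=
  pi_absolutelyContinuous _ _ fun _ => pi_absolutelyContinuous _ _ fun _ =>
    pi_absolutelyContinuous _ _ fun _ => pi_absolutelyContinuous _ _ fun _ =>
      complexGaussian_absolutelyContinuous

variable {W}

/-- The channels `H` with the links `(j, i) ∈ s` replaced by those of `H'`. -/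
noncomputable def resample (s : Set (Fin K × Fin K)) (H H' : W.Channels) : W.Channels := by
  classical exact fun j i => if (j, i) ∈ s then H' j i else H j i

theorem resample_of_mem {s : Set (Fin K × Fin K)} (H H' : W.Channels) {j i : Fin K}
    (h : (j, i) ∈ s) : resample s H H' j i = H' j i := if_pos h

theorem resample_of_notMem {s : Set (Fin K × Fin K)} (H H' : W.Channels) {j i : Fin K}
    (h : (j, i) ∉ s) : resample s H H' j i = H j i := if_neg h

theorem measurePreserving_resample (s : Set (Fin K × Fin K)) :
    MeasurePreserving (fun p : W.Channels × W.Channels => resample s p.1 p.2)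
      (W.channelLaw.prod W.channelLaw) W.channelLaw := by
  classical
  refine measurePreserving_pi_combine (α := fun j => ∀ i, Fin (W.M j) → Fin (W.N i) → ℂ) _
    (f := fun j p i => if (j, i) ∈ s then p.2 i else p.1 i) fun j => ?_
  refine measurePreserving_pi_combine _
    (f := fun i p => if (j, i) ∈ s then p.2 else p.1) fun i => ?_
  by_cases h : (j, i) ∈ s
  · simpa [h] using measurePreserving_snd
  · simpa [h] using measurePreserving_fst

/-- The channels `H` for which resampling the links in `s` leads into `A` with positive
probability. -/
def resampleSet (s : Set (Fin K × Fin K)) (A : Set W.Channels) : Set W.Channels :=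
  {H | 0 < W.channelLaw {H' | resample s H H' ∈ A}}

theorem measurableSet_resampleSet (s : Set (Fin K × Fin K)) {A : Set W.Channels}
    (hA : MeasurableSet A) : MeasurableSet (resampleSet s A) :=
  measurableSet_lt measurable_const
    (measurable_measure_prodMk_left ((measurePreserving_resample s).measurable hA))

theorem channelLaw_resampleSet_pos (s : Set (Fin K × Fin K)) {A : Set W.Channels}
    (hA : MeasurableSet A) (hpos : 0 < W.channelLaw A) :
    0 < W.channelLaw (resampleSet s A) := by
  by_contra h0
  have hmp := measurePreserving_resample (W := W) s
  rw [← hmp.measure_preimage hA.nullMeasurableSet] at hpos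
  refine hpos.ne' ((Measure.measure_prod_null (hmp.measurable hA)).2 ?_)
  have : ∀ᵐ H ∂W.channelLaw, H ∉ resampleSet s A := by
    rw [ae_iff]; simpa using h0
  filter_upwards [this] with H hH
  exact le_antisymm (not_lt.1 hH) zero_le

end Network

/-! ### Dimension count for generic bilinear systems -/

theorem exists_isUnit_submatrix_of_rank_eq {a m : ℕ} {A : Matrix (Fin a) (Fin m) ℂ}
    (h : A.rank = a) : ∃ e : Fin a → Fin m, Function.Injective e ∧ IsUnit (A.submatrix id e) := by
  obtain ⟨κ, g, hg, hspan, hli⟩ := exists_linearIndependent' ℂ A.col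
  have : Finite κ := Finite.of_injective g hg
  have := Fintype.ofFinite κ
  have hcard : Fintype.card κ = a := by
    rw [← finrank_span_eq_card hli, hspan, ← A.rank_eq_finrank_span_cols, h]
  let ε : Fin a ≃ κ := (Fintype.equivFinOfCardEq hcard).symm
  refine ⟨g ∘ ε, hg.comp ε.injective, ?_⟩
  rw [← Matrix.linearIndependent_cols_iff_isUnit]
  exact hli.comp ε ε.injective

theorem card_notMem_range {α β : Type*} [Fintype α] [Fintype β] {g : α → β}
    [Fintype {x // x ∉ Set.range g}] (hg : Function.Injective g) :
    (Fintype.card {x // x ∉ Set.range g} : ℤ) = Fintype.card β - Fintype.card α := by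
  classical
  have h := Fintype.card_subtype_compl (fun x => x ∈ Set.range g)
  have h2 : Fintype.card {x // x ∈ Set.range g} = Fintype.card α :=
    (Fintype.card_congr (Equiv.ofInjective g hg)).symm
  have h3 := Fintype.card_le_of_injective g hg
  rw [h2] at h
  have h4 : Fintype.card {x // x ∉ Set.range g} = Fintype.card β - Fintype.card α := by
    convert h
  omega

/-- The matrix that is `1` on the columns selected by `e`, with the entries `x` elsewhere. -/
noncomputable def chartRow {a m : ℕ} (e : Fin a → Fin m) (x : Fin a × {r // r ∉ Set.range e} → ℂ) :
    Matrix (Fin a) (Fin m) ℂ := by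
  classical exact Matrix.of fun k r =>
    if h : r ∈ Set.range e then (if r = e k then 1 else 0) else x (k, ⟨r, h⟩)

/-- The matrix that vanishes on the block selected by `e` and `f`, with the entries `g`
elsewhere. -/
noncomputable def chartLink {a m b n : ℕ} (e : Fin a → Fin m) (f : Fin b → Fin n)
    (g : {x // x ∉ Set.range (Prod.map e f)} → ℂ) : Matrix (Fin m) (Fin n) ℂ := by
  classical exact Matrix.of fun r c =>
    if h : (r, c) ∈ Set.range (Prod.map e f) then 0 else g ⟨(r, c), h⟩

/-- The columns selected by `e` from the identity matrix. -/
noncomputable def selector {a m : ℕ} (e : Fin a → Fin m) : Matrix (Fin m) (Fin a) ℂ :=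
  (1 : Matrix (Fin m) (Fin m) ℂ).submatrix id e

theorem mul_selector {a m : ℕ} {κ : Type*} (e : Fin a → Fin m) (A : Matrix κ (Fin m) ℂ) :
    A * selector e = A.submatrix id e := by
  ext; simp [selector, Matrix.mul_apply, Matrix.one_apply]

/-- The solution of `A G B = 0` in `G`, where `A` and `Bᵀ` are in the charts of `e` and `f`:
the block of `G` selected by `e` and `f` is determined by the remaining entries. -/
noncomputable def chartSolution {a m b n : ℕ} (e : Fin a → Fin m) (f : Fin b → Fin n)
    (x : Fin a × {r // r ∉ Set.range e} → ℂ) (y : Fin b × {c // c ∉ Set.range f} → ℂ)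
    (g : {x // x ∉ Set.range (Prod.map e f)} → ℂ) : Matrix (Fin m) (Fin n) ℂ :=
  chartLink e f g -
    selector e * (chartRow e x * chartLink e f g * (chartRow f y)ᵀ) * (selector f)ᵀ

theorem chartRow_eq {a m : ℕ} {e : Fin a → Fin m} (he : Function.Injective e)
    {A : Matrix (Fin a) (Fin m) ℂ} (h : A.submatrix id e = 1) :
    chartRow e (fun p => A p.1 p.2) = A := by
  ext k r
  by_cases hr : r ∈ Set.range e
  · obtain ⟨l, rfl⟩ := hr
    have := congrFun (congrFun h k) l
    simp only [Matrix.submatrix_apply, id, Matrix.one_apply] at this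
    simp [chartRow, this, he.eq_iff, eq_comm]
  · simp only [chartRow, Matrix.of_apply, dif_neg hr]

theorem eq_chartSolution {a m b n : ℕ} {e : Fin a → Fin m} {f : Fin b → Fin n}
    (he : Function.Injective e) (hf : Function.Injective f)
    {A : Matrix (Fin a) (Fin m) ℂ} {B : Matrix (Fin b) (Fin n) ℂ} {G : Matrix (Fin m) (Fin n) ℂ}
    (hA : A.submatrix id e = 1) (hB : B.submatrix id f = 1) (h : A * G * Bᵀ = 0) :
    G = chartSolution e f (fun p => A p.1 p.2) (fun p => B p.1 p.2) (fun p => G p.1.1 p.1.2) := by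
  rw [chartSolution, chartRow_eq he hA, chartRow_eq hf hB]
  set G' := chartLink e f (fun p => G p.1.1 p.1.2) with hG'
  have hdec : G = G' + selector e * G.submatrix e f * (selector f)ᵀ := by
    ext r c
    by_cases hrc : (r, c) ∈ Set.range (Prod.map e f)
    · obtain ⟨⟨k, l⟩, hkl⟩ := hrc
      simp only [Prod.map_apply, Prod.mk.injEq] at hkl
      obtain ⟨rfl, rfl⟩ := hkl
      have : (e k, f l) ∈ Set.range (Prod.map e f) := ⟨(k, l), rfl⟩
      simp only [hG', chartLink, Matrix.add_apply, Matrix.of_apply, dif_pos this]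
      simp [Matrix.mul_apply, selector, Matrix.one_apply, he.eq_iff, hf.eq_iff]
    · simp only [hG', chartLink, Matrix.add_apply, Matrix.of_apply, dif_neg hrc]
      rw [left_eq_add]
      simp only [Matrix.mul_apply, selector, Matrix.submatrix_apply, Matrix.transpose_apply, id,
        Matrix.one_apply]
      refine Finset.sum_eq_zero fun l _ => ?_
      rw [Finset.sum_mul]
      refine Finset.sum_eq_zero fun k _ => ?_
      by_cases h1 : r = e k
      · by_cases h2 : c = f l
        · exact absurd ⟨(k, l), by simp [h1, h2]⟩ hrc
        · simp [h2]
      · simp [h1]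
  have hblock : A * G' * Bᵀ + G.submatrix e f = 0 := by
    rw [← h]
    conv_rhs => rw [hdec]
    rw [Matrix.mul_add, Matrix.add_mul]
    congr 1
    have h1 : A * selector e = 1 := by rw [mul_selector, hA]
    have h2 : (selector f)ᵀ * Bᵀ = 1 := by
      rw [← Matrix.transpose_mul, mul_selector, hB, Matrix.transpose_one]
    calc G.submatrix e f = (A * selector e) * G.submatrix e f * ((selector f)ᵀ * Bᵀ) := by
          rw [h1, h2, Matrix.one_mul, Matrix.mul_one]
      _ = _ := by simp only [Matrix.mul_assoc]
  rw [eq_neg_of_add_eq_zero_left hblock]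
  conv_lhs => rw [hdec]
  simp

theorem differentiable_mul_apply {E l m n : Type*} [NormedAddCommGroup E] [NormedSpace ℝ E]
    [Fintype m] {A : E → Matrix l m ℂ} {B : E → Matrix m n ℂ}
    (hA : ∀ i j, Differentiable ℝ fun x => A x i j) (hB : ∀ i j, Differentiable ℝ fun x => B x i j)
    (i : l) (j : n) : Differentiable ℝ fun x => (A x * B x) i j := by
  simp only [Matrix.mul_apply]
  exact Differentiable.fun_sum fun k _ => (hA i k).mul (hB k j)

theorem differentiable_chartRow {E : Type*} [NormedAddCommGroup E] [NormedSpace ℝ E] {a m : ℕ}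
    (e : Fin a → Fin m) {x : E → Fin a × {r // r ∉ Set.range e} → ℂ} (hx : Differentiable ℝ x)
    (k : Fin a) (r : Fin m) : Differentiable ℝ fun z => chartRow e (x z) k r := by
  by_cases hr : r ∈ Set.range e
  · simp only [chartRow, Matrix.of_apply, dif_pos hr]
    exact differentiable_const _
  · simp only [chartRow, Matrix.of_apply, dif_neg hr]
    fun_prop

theorem differentiable_chartLink {E : Type*} [NormedAddCommGroup E] [NormedSpace ℝ E]
    {a m b n : ℕ} (e : Fin a → Fin m) (f : Fin b → Fin n)
    {g : E → {x // x ∉ Set.range (Prod.map e f)} → ℂ} (hg : Differentiable ℝ g)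
    (r : Fin m) (c : Fin n) : Differentiable ℝ fun z => chartLink e f (g z) r c := by
  by_cases hr : (r, c) ∈ Set.range (Prod.map e f)
  · simp only [chartLink, Matrix.of_apply, dif_pos hr]
    exact differentiable_const _
  · simp only [chartLink, Matrix.of_apply, dif_neg hr]
    fun_prop

theorem differentiable_chartSolution {E : Type*} [NormedAddCommGroup E] [NormedSpace ℝ E]
    {a m b n : ℕ} (e : Fin a → Fin m) (f : Fin b → Fin n)
    {x : E → Fin a × {r // r ∉ Set.range e} → ℂ} {y : E → Fin b × {c // c ∉ Set.range f} → ℂ}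
    {g : E → {x // x ∉ Set.range (Prod.map e f)} → ℂ}
    (hx : Differentiable ℝ x) (hy : Differentiable ℝ y) (hg : Differentiable ℝ g)
    (r : Fin m) (c : Fin n) :
    Differentiable ℝ fun z => chartSolution e f (x z) (y z) (g z) r c := by
  have hG := differentiable_chartLink e f hg
  have h1 := differentiable_mul_apply (differentiable_chartRow e hx) hG
  have h2 := differentiable_mul_apply (B := fun z => (chartRow f (y z))ᵀ) h1
    fun i j => differentiable_chartRow f hy j i
  have h3 := differentiable_mul_apply (A := fun _ : E => selector e)
    (fun _ _ => differentiable_const _) h2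
  have h4 := differentiable_mul_apply (B := fun _ : E => (selector f)ᵀ) h3
    fun _ _ => differentiable_const _
  exact (hG r c).sub (h4 r c)

theorem finrank_real_fun_complex (ι : Type*) [Fintype ι] :
    Module.finrank ℝ (ι → ℂ) = 2 * Fintype.card ι := by
  simp [Module.finrank_pi_fintype, mul_comm]

/-- **Generic bilinear systems.** For `J` and `I` indexing unknown matrices `A j` and `B i` of full
rank, and `Λ` indexing the equations `A (s l) * G l * B (t l) = 0`, the coefficients `G` for which
the system is solvable form a null set as soon as there are more scalar equations than the
Grassmannians of the row spaces of the `A j` and the column spaces of the `B i` have dimensions. -/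
theorem volume_solvable_eq_zero {Λ J I : Type*} [Fintype Λ] [Fintype J] [Fintype I]
    (s : Λ → J) (t : Λ → I) (a m : J → ℕ) (b n : I → ℕ)
    (hlt : ∑ j, (a j : ℤ) * (m j - a j) + ∑ i, (b i : ℤ) * (n i - b i) <
      ∑ l, (a (s l) : ℤ) * b (t l)) :
    volume {G : ∀ l, Fin (m (s l)) → Fin (n (t l)) → ℂ |
      ∃ (A : ∀ j, Matrix (Fin (a j)) (Fin (m j)) ℂ) (B : ∀ i, Matrix (Fin (n i)) (Fin (b i)) ℂ),
        (∀ j, (A j).rank = a j) ∧ (∀ i, (B i).rank = b i) ∧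
          ∀ l, A (s l) * Matrix.of (G l) * B (t l) = 0} = 0 := by
  classical
  let Φ (e : ∀ j, Fin (a j) → Fin (m j)) (f : ∀ i, Fin (b i) → Fin (n i))
      (z : ((Σ j, Fin (a j) × {r // r ∉ Set.range (e j)}) → ℂ) ×
        ((Σ i, Fin (b i) × {c // c ∉ Set.range (f i)}) → ℂ) ×
        ((Σ l, {x // x ∉ Set.range (Prod.map (e (s l)) (f (t l)))}) → ℂ)) :
      ∀ l, Fin (m (s l)) → Fin (n (t l)) → ℂ := fun l =>
    chartSolution (e (s l)) (f (t l)) (fun p => z.1 ⟨s l, p⟩) (fun p => z.2.1 ⟨t l, p⟩)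
      (fun p => z.2.2 ⟨l, p⟩)
  -- Normalizing `A j` and `B i` on an invertible minor covers the set by finitely many charts.
  refine measure_mono_null (t := ⋃ (e) (f) (_ : (∀ j, Function.Injective (e j)) ∧
    ∀ i, Function.Injective (f i)), Set.range (Φ e f)) ?_ ?_
  · rintro G ⟨A, B, hA, hB, h⟩
    choose e he hAe using fun j => exists_isUnit_submatrix_of_rank_eq (hA j)
    choose f hf hBf using fun i =>
      exists_isUnit_submatrix_of_rank_eq (A := (B i)ᵀ) (by rw [Matrix.rank_transpose, hB])
    simp only [Set.mem_iUnion]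
    refine ⟨e, f, ⟨he, hf⟩, ?_⟩
    let A' : ∀ j, Matrix (Fin (a j)) (Fin (m j)) ℂ := fun j => ((A j).submatrix id (e j))⁻¹ * A j
    let B' : ∀ i, Matrix (Fin (b i)) (Fin (n i)) ℂ :=
      fun i => ((B i)ᵀ.submatrix id (f i))⁻¹ * (B i)ᵀ
    have hA' : ∀ j, (A' j).submatrix id (e j) = 1 := fun j => by
      rw [← mul_selector, Matrix.mul_assoc, mul_selector]
      exact Matrix.nonsing_inv_mul _ ((Matrix.isUnit_iff_isUnit_det _).1 (hAe j))
    have hB' : ∀ i, (B' i).submatrix id (f i) = 1 := fun i => by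
      rw [← mul_selector, Matrix.mul_assoc, mul_selector]
      exact Matrix.nonsing_inv_mul _ ((Matrix.isUnit_iff_isUnit_det _).1 (hBf i))
    refine ⟨(fun p => A' p.1 p.2.1 p.2.2, fun p => B' p.1 p.2.1 p.2.2,
      fun p => G p.1 p.2.1.1 p.2.1.2), ?_⟩
    funext l
    refine (eq_chartSolution (he (s l)) (hf (t l)) (hA' (s l)) (hB' (t l))
      (G := Matrix.of (G l)) ?_).symm
    calc A' (s l) * Matrix.of (G l) * (B' (t l))ᵀ
        = ((A (s l)).submatrix id (e (s l)))⁻¹ * (A (s l) * Matrix.of (G l) * B (t l)) *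
            (((B (t l))ᵀ.submatrix id (f (t l)))⁻¹)ᵀ := by
          simp only [A', B', Matrix.transpose_mul, Matrix.transpose_transpose, Matrix.mul_assoc]
      _ = 0 := by rw [h l, Matrix.mul_zero, Matrix.zero_mul]
  -- Each chart has fewer parameters than the space of coefficients has dimensions.
  · refine measure_iUnion_null fun e => measure_iUnion_null fun f =>
      measure_iUnion_null fun hef => ?_
    have := isAddHaarMeasure_volume_matrices (fun l => m (s l)) (fun l => n (t l))
    refine addHaar_range_eq_zero_of_finrank_lt volume ?_ ?_
    · refine differentiable_pi.2 fun l => differentiable_pi.2 fun r =>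
        differentiable_pi.2 fun c => ?_
      refine differentiable_chartSolution _ _ ?_ ?_ ?_ r c <;> fun_prop
    · have hcard : Module.finrank ℝ (∀ l, Fin (m (s l)) → Fin (n (t l)) → ℂ) =
          2 * ∑ l, m (s l) * n (t l) := by
        simp [Module.finrank_pi_fintype, Finset.mul_sum, mul_assoc, mul_comm]
      rw [Module.finrank_prod, Module.finrank_prod, finrank_real_fun_complex,
        finrank_real_fun_complex, finrank_real_fun_complex, hcard]
      simp only [Fintype.card_sigma, Fintype.card_prod, Fintype.card_fin]
      zify
      simp only [card_notMem_range (hef.1 _), card_notMem_range (hef.2 _),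
        card_notMem_range ((hef.1 _).prodMap (hef.2 _)), Fintype.card_prod, Fintype.card_fin,
        Finset.sum_sub_distrib]
      push_cast
      linarith

theorem exists_right_inverse_of_rank_eq {a m : ℕ} {A : Matrix (Fin a) (Fin m) ℂ}
    (h : A.rank = a) : ∃ A' : Matrix (Fin m) (Fin a) ℂ, A * A' = 1 := by
  obtain ⟨e, -, he⟩ := exists_isUnit_submatrix_of_rank_eq h
  refine ⟨selector e * (A.submatrix id e)⁻¹, ?_⟩
  rw [← Matrix.mul_assoc, mul_selector]
  exact Matrix.mul_nonsing_inv _ ((Matrix.isUnit_iff_isUnit_det _).1 he)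

theorem exists_left_inverse_of_rank_eq {n b : ℕ} {B : Matrix (Fin n) (Fin b) ℂ}
    (h : B.rank = b) : ∃ B' : Matrix (Fin b) (Fin n) ℂ, B' * B = 1 := by
  obtain ⟨X, hX⟩ := exists_right_inverse_of_rank_eq (A := Bᵀ) (by rw [Matrix.rank_transpose, h])
  exact ⟨Xᵀ, by simpa using congrArg Matrix.transpose hX⟩

/-- The dimension count for the channels seen through receive filters `P j` and transmit
filters `Q i` of full rank: if the bilinear system on the links `Ω` is solvable with positive
probability, then it has at most as many equations as free variables. -/
theorem sum_le_of_channelLaw_pos {K : ℕ} {W : Network K} (J I : Finset (Fin K))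
    (Ω : Finset (Fin K × Fin K)) (hΩ : Ω ⊆ J ×ˢ I) (a m b n : Fin K → ℕ)
    (P : ∀ j, Matrix (Fin (m j)) (Fin (W.M j)) ℂ) (Q : ∀ i, Matrix (Fin (W.N i)) (Fin (n i)) ℂ)
    (hP : ∀ j ∈ J, (P j).rank = m j) (hQ : ∀ i ∈ I, (Q i).rank = n i)
    {s : Set W.Channels} (hs : 0 < W.channelLaw s)
    (h : ∀ H ∈ s, ∃ (A : ∀ j, Matrix (Fin (a j)) (Fin (m j)) ℂ)
      (B : ∀ i, Matrix (Fin (n i)) (Fin (b i)) ℂ),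
      (∀ j ∈ J, (A j).rank = a j) ∧ (∀ i ∈ I, (B i).rank = b i) ∧
        ∀ p ∈ Ω, A p.1 * (P p.1 * W.fading H p.1 p.2 * Q p.2) * B p.2 = 0) :
    ∑ p ∈ Ω, (a p.1 : ℤ) * b p.2 ≤
      ∑ j ∈ J, (a j : ℤ) * (m j - a j) + ∑ i ∈ I, (b i : ℤ) * (n i - b i) := by
  by_contra hlt
  rw [not_le] at hlt
  have hΩJ : ∀ p : Ω, p.1.1 ∈ J := fun p => (Finset.mem_product.1 (hΩ p.2)).1
  have hΩI : ∀ p : Ω, p.1.2 ∈ I := fun p => (Finset.mem_product.1 (hΩ p.2)).2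
  have hnull := volume_solvable_eq_zero (Λ := Ω) (J := J) (I := I) (fun p => ⟨p.1.1, hΩJ p⟩)
    (fun p => ⟨p.1.2, hΩI p⟩) (fun j => a j) (fun j => m j) (fun i => b i) (fun i => n i) (by
      rw [Finset.sum_coe_sort Ω (fun p => (a p.1 : ℤ) * b p.2),
        Finset.sum_coe_sort J (fun j => (a j : ℤ) * (m j - a j)),
        Finset.sum_coe_sort I (fun i => (b i : ℤ) * (n i - b i))]
      exact hlt)
  -- The effective channels are a linear image of the channels, and onto since the filters have
  -- full rank.
  let T : W.Channels →ₗ[ℝ] (∀ p : Ω, Fin (m p.1.1) → Fin (n p.1.2) → ℂ) :=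
    { toFun := fun H p => P p.1.1 * W.fading H p.1.1 p.1.2 * Q p.1.2
      map_add' := fun H H' => by
        funext p
        have : W.fading (H + H') p.1.1 p.1.2 =
          W.fading H p.1.1 p.1.2 + W.fading H' p.1.1 p.1.2 := rfl
        simp only [this, Matrix.mul_add, Matrix.add_mul]
        rfl
      map_smul' := fun c H => by
        funext p
        have : W.fading (c • H) p.1.1 p.1.2 = c • W.fading H p.1.1 p.1.2 := rfl
        simp only [this, Matrix.mul_smul, Matrix.smul_mul]
        rfl }
  have hT : Function.Surjective T := by
    classical
    intro G
    choose P' hP' using fun j hj => exists_right_inverse_of_rank_eq (hP j hj)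
    choose Q' hQ' using fun i hi => exists_left_inverse_of_rank_eq (hQ i hi)
    let X (j i : Fin K) : Matrix (Fin (W.M j)) (Fin (W.N i)) ℂ := if hp : (j, i) ∈ Ω then
      P' j (hΩJ ⟨_, hp⟩) * Matrix.of (G ⟨(j, i), hp⟩) * Q' i (hΩI ⟨_, hp⟩) else 0
    refine ⟨X, ?_⟩
    funext p
    obtain ⟨⟨j, i⟩, hp⟩ := p
    have hX : X j i = P' j (hΩJ ⟨_, hp⟩) * Matrix.of (G ⟨(j, i), hp⟩) * Q' i (hΩI ⟨_, hp⟩) :=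
      dif_pos hp
    change P j * X j i * Q i = Matrix.of (G ⟨(j, i), hp⟩)
    rw [hX]
    rw [← Matrix.mul_assoc, ← Matrix.mul_assoc, hP', Matrix.one_mul, Matrix.mul_assoc, hQ',
      Matrix.mul_one]
  have := isAddHaarMeasure_volume_channels W
  have := isAddHaarMeasure_volume_matrices (fun p : Ω => m p.1.1) (fun p : Ω => n p.1.2)
  refine hs.ne' (W.channelLaw_absolutelyContinuous (measure_mono_null (fun H hH => ?_)
    (addHaar_preimage_eq_zero volume volume T hT hnull)))
  obtain ⟨A, B, hA, hB, hAB⟩ := h H hH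
  exact ⟨fun j => A j, fun i => B i, fun j => hA j j.2, fun i => hB i i.2, fun p => hAB p p.2⟩

/-! ### Linear algebra of the filters -/

/-- A submodule of row vectors is the row space of a matrix with independent rows. -/
theorem exists_row_basis {m : ℕ} (E : Submodule ℂ (Fin m → ℂ)) :
    ∃ (w : ℕ) (Q : Matrix (Fin w) (Fin m) ℂ), LinearIndependent ℂ Q.row ∧ (∀ k, Q k ∈ E) ∧
      ∀ {κ : Type} (X : Matrix κ (Fin m) ℂ), (∀ k, X k ∈ E) →
        ∃ Y : Matrix κ (Fin w) ℂ, X = Y * Q := by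
  let β := Module.finBasis ℂ E
  refine ⟨_, Matrix.of fun k => (β k : Fin m → ℂ), ?_, fun k => (β k).2, fun X hX => ?_⟩
  · exact β.linearIndependent.map' E.subtype E.ker_subtype
  · refine ⟨Matrix.of fun k => β.repr ⟨X k, hX k⟩, ?_⟩
    ext k c
    have h := congrFun (congrArg Subtype.val (β.sum_repr ⟨X k, hX k⟩)) c
    rw [Submodule.coe_sum, Finset.sum_apply] at h
    rw [Matrix.mul_apply]
    exact h.symm

theorem exists_eq_mul_of_colSpace_le {m n κ : Type*} [Fintype n] [Fintype κ] [DecidableEq κ]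
    {A : Matrix m n ℂ} {B : Matrix m κ ℂ} (h : colSpace B ≤ colSpace A) :
    ∃ Q : Matrix n κ ℂ, B = A * Q := by
  have h' : ∀ c, ∃ x, A *ᵥ x = B.col c := fun c => h ⟨Pi.single c 1, by simp⟩
  choose x hx using h'
  refine ⟨(Matrix.of x)ᵀ, ?_⟩
  ext r c
  simpa [Matrix.mul_apply, Matrix.mulVec, dotProduct] using (congrFun (hx c) r).symm

theorem padRows_mul {m n : ℕ} {κ l : Type*} [Fintype κ] (A : Matrix (Fin m) κ ℂ)
    (B : Matrix κ l ℂ) : padRows n (A * B) = padRows n A * B := by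
  ext r c
  by_cases h : (r : ℕ) < m <;> simp [padRows, Matrix.mul_apply, h]

theorem sum_padRows {m n : ℕ} (hmn : m ≤ n) {κ : Type*} (A : Matrix (Fin m) κ ℂ) (k : κ)
    (f : Fin n → ℂ → ℂ) (hf : ∀ r, f r 0 = 0) :
    ∑ r, f r (padRows n A r k) = ∑ r, f (Fin.castLE hmn r) (A r k) := by
  symm
  refine Finset.sum_of_injOn (Fin.castLE hmn) (Fin.castLE_injective hmn).injOn (by simp) ?_ ?_
  · intro r _ hr
    have : ¬ (r : ℕ) < m := fun h => hr ⟨⟨r, h⟩, by simp, rfl⟩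
    simp [padRows, this, hf]
  · intro r _
    simp [padRows]

theorem mul_padRows {m n : ℕ} (hmn : m ≤ n) {l κ : Type*} (B : Matrix l (Fin n) ℂ)
    (A : Matrix (Fin m) κ ℂ) : B * padRows n A = B.submatrix id (Fin.castLE hmn) * A := by
  ext i k
  simp only [Matrix.mul_apply, Matrix.submatrix_apply, id]
  exact sum_padRows hmn A k (fun r z => B i r * z) (by simp)

theorem conjTranspose_padRows_mul {m n : ℕ} (hmn : m ≤ n) {l κ : Type*} (A : Matrix (Fin m) κ ℂ)
    (B : Matrix (Fin n) l ℂ) : (padRows n A)ᴴ * B = Aᴴ * B.submatrix (Fin.castLE hmn) id := by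
  have := congrArg Matrix.conjTranspose (mul_padRows hmn Bᴴ A)
  simpa [Matrix.conjTranspose_mul, Matrix.conjTranspose_submatrix] using this

theorem conjTranspose_padRows_mul_padRows {m n : ℕ} (hmn : m ≤ n) {κ l : Type*}
    (A : Matrix (Fin m) κ ℂ) (B : Matrix (Fin m) l ℂ) : (padRows n A)ᴴ * padRows n B = Aᴴ * B := by
  rw [conjTranspose_padRows_mul hmn]
  congr 1
  ext r c
  simp [padRows]

theorem eq_of_rank_mul_eq_right {l m : Type*} [Fintype m] {d : ℕ} {A : Matrix l m ℂ}
    {B : Matrix m (Fin d) ℂ} (h : (A * B).rank = d) : B.rank = d :=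
  le_antisymm (B.rank_le_card_width.trans_eq (Fintype.card_fin d))
    (h.ge.trans (Matrix.rank_mul_le_right A B))

theorem eq_of_rank_mul_eq_left {m n : Type*} [Fintype m] [Fintype n] {d : ℕ}
    {A : Matrix (Fin d) m ℂ} {B : Matrix m n ℂ} (h : (A * B).rank = d) : A.rank = d :=
  le_antisymm (A.rank_le_card_height.trans_eq (Fintype.card_fin d))
    (h.ge.trans (Matrix.rank_mul_le_left A B))

namespace FeedbackProfile

variable {K : ℕ} {W : Network K} (L : FeedbackProfile W)

theorem padRows_mul_fading_mul_padRows (H : W.Channels) (j i : Fin K) {κ l : Type*}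
    (X : Matrix (Fin (L.Ms j)) κ ℂ) (Y : Matrix (Fin (L.Ns i)) l ℂ) :
    (padRows (W.M j) X)ᴴ * W.fading H j i * padRows (W.N i) Y = Xᴴ * L.sub H j i * Y := by
  rw [mul_padRows (L.Ns_le i), conjTranspose_padRows_mul (L.Ms_le j)]
  rfl

variable {L}

theorem sub_congr {H G : W.Channels} {j i : Fin K} (h : H j i = G j i) :
    L.sub H j i = L.sub G j i := by
  simp only [sub, Network.fading, h]

variable {H G : W.Channels} {S S' : ∀ j, Matrix (Fin (L.Ms j)) (Fin (L.Me j).toNat) ℂ}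
  {T T' : ∀ i, Matrix (Fin (L.Ns i)) (Fin (L.Ne i).toNat) ℂ}

theorem IsReceiveFilter.congr (h : ∀ j, ∀ i ∈ L.Ω .II j, H j i = G j i)
    (hS : L.IsReceiveFilter H S) : L.IsReceiveFilter G S := by
  intro j
  refine ⟨(hS j).1, (hS j).2.trans ?_⟩
  congr 1
  ext r c
  simp only [blockRow, Matrix.of_apply, sub_congr (h j c.1 c.1.2)]

theorem IsTransmitFilter.congr (h : ∀ j, ∀ i ∈ L.Ω .III j, H j i = G j i)
    (hT : L.IsTransmitFilter H S T) : L.IsTransmitFilter G S T := by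
  intro i
  refine ⟨(hT i).1, (hT i).2.trans ?_⟩
  refine iInf_congr fun j => iInf_congr fun hij => ?_
  rw [sub_congr (h j i hij)]

theorem feedback_congr (h3 : ∀ j, ∀ i ∈ L.Ω .III j, H j i = G j i)
    (h4 : ∀ j, ∀ i ∈ L.Ω .IV j, H j i = G j i) : L.feedback H S = L.feedback G S := by
  funext j
  refine Prod.ext (funext fun p => ?_) ?_
  · simp only [feedback, sub_congr (h3 j p p.2)]
  · simp only [feedback]
    congr 2
    ext r c
    simp only [blockRow, Matrix.of_apply, sub_congr (h4 j c.1 c.1.2)]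

theorem IsReceiveFilter.exists_eq_mul (hS : L.IsReceiveFilter H S)
    (hS' : L.IsReceiveFilter H S') (j : Fin K) :
    ∃ X : Matrix (Fin (L.Me j).toNat) (Fin (L.Me j).toNat) ℂ, S' j = S j * X :=
  exists_eq_mul_of_colSpace_le ((hS' j).2.trans (hS j).2.symm).le

theorem iInf_nullSpace_eq (hS : L.IsReceiveFilter H S) (hS' : L.IsReceiveFilter H S')
    (i : Fin K) :
    (⨅ j, ⨅ _ : i ∈ L.Ω .III j, nullSpace ((S j)ᴴ * L.sub H j i)) =
      ⨅ j, ⨅ _ : i ∈ L.Ω .III j, nullSpace ((S' j)ᴴ * L.sub H j i) := by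
  refine iInf_congr fun j => iInf_congr fun hij => ?_
  exact congrFun (congrArg Prod.fst (congrFun (L.feedback_unique H hS hS') j)) ⟨i, hij⟩

theorem IsTransmitFilter.exists_eq_mul (hS : L.IsReceiveFilter H S)
    (hS' : L.IsReceiveFilter H S') (hT : L.IsTransmitFilter H S T)
    (hT' : L.IsTransmitFilter H S' T') (i : Fin K) :
    ∃ X : Matrix (Fin (L.Ne i).toNat) (Fin (L.Ne i).toNat) ℂ, T' i = T i * X :=
  exists_eq_mul_of_colSpace_le
    ((hT' i).2.trans ((iInf_nullSpace_eq hS hS' i).symm.trans (hT i).2.symm)).le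

variable (L) in
/-- The links treated by the strategy `m`. -/
def links (m : Strategy) : Set (Fin K × Fin K) := {p | p.2 ∈ L.Ω m p.1}

theorem resample_links_of_ne {m m' : Strategy} (h : m' ≠ m) {H H' : W.Channels} {j i : Fin K}
    (hi : i ∈ L.Ω m' j) : Network.resample (L.links m) H H' j i = H j i :=
  Network.resample_of_notMem _ _ fun hm => Finset.disjoint_left.1 (L.disjoint j m' m h) hi hm

theorem rank_submatrix_castLE {d w m : ℕ} (h : d ≤ w) {Q : Matrix (Fin w) (Fin m) ℂ}
    (hQ : LinearIndependent ℂ Q.row) : (Q.submatrix (Fin.castLE h) id).rank = d := by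
  have : LinearIndependent ℂ (Q.submatrix (Fin.castLE h) id).row :=
    hQ.comp _ (Fin.castLE_injective h)
  simpa using this.rank_matrix

theorem rank_padRows {m n d : ℕ} (hmn : m ≤ n) {T : Matrix (Fin m) (Fin d) ℂ} (hT : Tᴴ * T = 1) :
    (padRows n T).rank = d := by
  refine eq_of_rank_mul_eq_right (A := (padRows n T)ᴴ) ?_
  rw [conjTranspose_padRows_mul_padRows hmn, hT, Matrix.rank_one, Fintype.card_fin]

theorem rank_conjTranspose_padRows {m n d : ℕ} (hmn : m ≤ n) {S : Matrix (Fin m) (Fin d) ℂ}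
    (hS : Sᴴ * S = 1) : (padRows n S)ᴴ.rank = d := by
  refine eq_of_rank_mul_eq_left (B := padRows n S) ?_
  rw [conjTranspose_padRows_mul_padRows hmn, hS, Matrix.rank_one, Fintype.card_fin]

/-! ### Conditioning on all links but those of one strategy -/

/-- Some full rank precoders leave room at every receiver `j` for `d0 j` (not just `d j`)
independent decorrelator rows `A j * (S j)ᴴ` that cancel the interference from the strategy IV
links. The direct links and the strategy I links do not enter. -/
def HasRoom (L : FeedbackProfile W) (H : W.Channels) : Prop :=
  ∃ (S : ∀ j, Matrix (Fin (L.Ms j)) (Fin (L.Me j).toNat) ℂ)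
    (T : ∀ i, Matrix (Fin (L.Ns i)) (Fin (L.Ne i).toNat) ℂ)
    (A : ∀ j, Matrix (Fin (L.d0 j)) (Fin (L.Me j).toNat) ℂ)
    (Va : ∀ i, Matrix (Fin (L.Ne i).toNat) (Fin (W.d i)) ℂ),
    L.IsReceiveFilter H S ∧ L.IsTransmitFilter H S T ∧
    (∀ j, (A j).rank = L.d0 j) ∧ (∀ i, (Va i).rank = W.d i) ∧
    ∀ j, ∀ q ∈ L.Ω .IV j, A j * (S j)ᴴ * L.sub H j q * (T q * Va q) = 0

/-- The precoders are fixed by the links outside strategy I, so the interference that the strategy I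
links cause is generic and takes up `∑ i ∈ Ω I j, d i` further dimensions at receiver `j`. -/
theorem hasRoom_of_mem_resampleSet (hd : ∀ i, 1 ≤ W.d i)
    {v : ∀ i, L.Feedback → Matrix (Fin (W.N i)) (Fin (W.d i)) ℂ} {s : Set W.Channels}
    (hs : ∀ H ∈ s, L.SolvesAt v H) {H : W.Channels}
    (hH : H ∈ Network.resampleSet (L.links .I) s) : L.HasRoom H := by
  have h2 : ∀ H' : W.Channels, ∀ j, ∀ i ∈ L.Ω .II j,
      Network.resample (L.links .I) H H' j i = H j i := fun H' j i =>
    resample_links_of_ne (by simp)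
  have h3 : ∀ H' : W.Channels, ∀ j, ∀ i ∈ L.Ω .III j,
      Network.resample (L.links .I) H H' j i = H j i := fun H' j i =>
    resample_links_of_ne (by simp)
  have h4 : ∀ H' : W.Channels, ∀ j, ∀ i ∈ L.Ω .IV j,
      Network.resample (L.links .I) H H' j i = H j i := fun H' j i =>
    resample_links_of_ne (by simp)
  obtain ⟨H₀, hH₀⟩ : {H' | Network.resample (L.links .I) H H' ∈ s}.Nonempty :=
    nonempty_of_measure_ne_zero (ne_of_gt hH)
  obtain ⟨S, T, R₀, Va, Ua₀, hS₀, hT₀, -, hV₀, hal₀⟩ := hs _ hH₀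
  have hS := hS₀.congr (h2 H₀)
  have hT := hT₀.congr (h3 H₀)
  rw [feedback_congr (h3 H₀) (h4 H₀)] at hV₀ hal₀
  have hVr : ∀ i, (v i (L.feedback H S)).rank = W.d i := fun i =>
    eq_of_rank_mul_eq_right (hal₀.1 i)
  have hVar : ∀ i, (Va i).rank = W.d i := fun i =>
    eq_of_rank_mul_eq_right (A := padRows (W.N i) (T i)) (by
      rw [← padRows_mul, ← hV₀, hVr])
  -- `E j`: the decorrelator rows that cancel the interference from the strategy IV links.
  let E (j : Fin K) : Submodule ℂ (Fin (L.Me j).toNat → ℂ) :=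
    ⨅ q ∈ L.Ω .IV j, LinearMap.ker ((S j)ᴴ * L.sub H j q * (T q * Va q)).vecMulLinear
  have hE : ∀ j x, x ∈ E j ↔
      ∀ q ∈ L.Ω .IV j, x ᵥ* ((S j)ᴴ * L.sub H j q * (T q * Va q)) = 0 := by
    intro j x
    simp [E, Submodule.mem_iInf]
  have hErow : ∀ {l : Type} j (X : Matrix l (Fin (L.Me j).toNat) ℂ), (∀ k, X k ∈ E j) ↔
      ∀ q ∈ L.Ω .IV j, X * (S j)ᴴ * L.sub H j q * (T q * Va q) = 0 := by
    intro l j X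
    constructor
    · intro h q hq
      ext k c
      rw [Matrix.mul_assoc, Matrix.mul_assoc, ← Matrix.mul_assoc (S j)ᴴ]
      exact congrFun ((hE j _).1 (h k) q hq) c
    · intro h k
      refine (hE j _).2 fun q hq => ?_
      have := congrFun (h q hq) k
      rw [Matrix.mul_assoc, Matrix.mul_assoc, ← Matrix.mul_assoc (S j)ᴴ] at this
      exact this
  choose w Q hQli hQE hQ using fun j => exists_row_basis (E j)
  have hQrank : ∀ j, (Q j).rank = w j := fun j => by simpa using (hQli j).rank_matrix
  -- The dimension count for receiver `j` alone, its decorrelator rows confined to `E j` and the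
  -- precoders fixed (`n = b = d`, so that they contribute no free variables).
  have hw : ∀ j, L.d0 j ≤ w j := by
    intro j
    have hsum := sum_le_of_channelLaw_pos (W := W) {j} (L.Ω .I j) ({j} ×ˢ L.Ω .I j) subset_rfl
      W.d w W.d W.d (fun j => Q j * (padRows (W.M j) (S j))ᴴ) (fun i => v i (L.feedback H S))
      (fun j _ => ?_) (fun i _ => hVr i) (s := {H' | Network.resample (L.links .I) H H' ∈ s}) hH ?_
    · simp only [Finset.sum_product, Finset.sum_singleton, ← Finset.mul_sum, sub_self,
        mul_zero, Finset.sum_const_zero, add_zero] at hsum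
      have hpos : (0 : ℤ) < W.d j := by exact_mod_cast hd j
      have := le_of_mul_le_mul_left hsum hpos
      rw [d0]
      zify
      linarith
    · obtain ⟨Q', hQ'⟩ := exists_right_inverse_of_rank_eq (hQrank j)
      refine eq_of_rank_mul_eq_left (B := padRows (W.M j) (S j) * Q') ?_
      rw [Matrix.mul_assoc, ← Matrix.mul_assoc _ _ Q',
        conjTranspose_padRows_mul_padRows (L.Ms_le j), (hS j).1, Matrix.one_mul, hQ',
        Matrix.rank_one, Fintype.card_fin]
    · intro H' hH'
      obtain ⟨S', T', R, Va', Ua, hS', -, -, -, hal⟩ := hs _ hH'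
      have hS'' := hS'.congr (h2 H')
      rw [feedback_congr (h3 H') (h4 H'), L.feedback_unique H hS'' hS] at hal
      choose X hX using hS.exists_eq_mul hS''
      -- The decorrelators, written in terms of the filters `S`.
      let Y (j : Fin K) : Matrix (Fin (W.d j)) (Fin (L.Me j).toNat) ℂ := (X j * (R j)ᴴ * Ua j)ᴴ
      have hU : ∀ j, padRows (W.M j) (S' j * (R j)ᴴ * Ua j) =
          padRows (W.M j) (S j * (Y j)ᴴ) := fun j => by
        simp only [Y, hX, Matrix.conjTranspose_conjTranspose, Matrix.mul_assoc]
      simp only [IsAligned, hU] at hal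
      have hYE : ∀ j, ∀ k, Y j k ∈ E j := fun j => (hErow j _).2 fun q hq => by
        have h0 := hal.2 q j ((L.cover j q).1 ⟨_, hq⟩)
        rw [hV₀, padRows_mul_fading_mul_padRows] at h0
        rw [sub_congr (h4 H' j q hq)] at h0
        simpa [Matrix.conjTranspose_mul] using h0
      choose Z hZ using fun j => hQ j (Y j) (hYE j)
      have hUZ : ∀ j, (padRows (W.M j) (S j * (Y j)ᴴ))ᴴ =
          Z j * (Q j * (padRows (W.M j) (S j))ᴴ) := fun j => by
        rw [padRows_mul, Matrix.conjTranspose_mul, Matrix.conjTranspose_conjTranspose,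
          ← Matrix.mul_assoc, ← hZ]
      simp only [hUZ] at hal
      refine ⟨Z, fun i => 1, fun j _ => ?_, fun i _ => by simp, ?_⟩
      · refine eq_of_rank_mul_eq_left (B := (Q j * (padRows (W.M j) (S j))ᴴ) *
          (W.fading (Network.resample (L.links .I) H H') j j * v j (L.feedback H S))) ?_
        simpa only [Matrix.mul_assoc] using hal.1 j
      · rintro ⟨j', i⟩ hp
        obtain ⟨hj, hi⟩ := Finset.mem_product.1 hp
        obtain rfl := Finset.mem_singleton.1 hj
        have h0 := hal.2 i j' ((L.cover j' i).1 ⟨_, hi⟩)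
        have hf : W.fading (Network.resample (L.links .I) H H') j' i = W.fading H' j' i := by
          simp only [Network.fading]
          rw [Network.resample_of_mem H H' (show (j', i) ∈ L.links .I from hi)]
        rw [hf] at h0
        rw [Matrix.mul_one, ← h0]
        simp only [Matrix.mul_assoc]
  refine ⟨S, T, fun j => (Q j).submatrix (Fin.castLE (hw j)) id, Va, hS, hT,
    fun j => rank_submatrix_castLE (hw j) (hQli j), hVar, fun j => ?_⟩
  exact (hErow j _).1 fun k => hQE j _

theorem Feasible.hasRoom (hd : ∀ i, 1 ≤ W.d i) (h : L.Feasible) :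
    ∃ s : Set W.Channels, MeasurableSet s ∧ 0 < W.channelLaw s ∧ ∀ H ∈ s, L.HasRoom H := by
  obtain ⟨v, s, hsm, hpos, hs⟩ := h
  exact ⟨_, Network.measurableSet_resampleSet _ hsm, Network.channelLaw_resampleSet_pos _ hsm hpos,
    fun H hH => hasRoom_of_mem_resampleSet hd hs hH⟩

theorem HasRoom.le_Ne {H : W.Channels} (hd : ∀ i, 1 ≤ W.d i) (h : L.HasRoom H) (i : Fin K) :
    (W.d i : ℤ) ≤ L.Ne i := by
  obtain ⟨-, -, -, Va, -, -, -, hV, -⟩ := h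
  -- `toNat` is harmless: `d i ≥ 1` rules out a negative `Ne i`.
  have h1 := (Va i).rank_le_height
  have := hd i
  rw [hV i] at h1
  omega

theorem HasRoom.le_Me {H : W.Channels} (hd : ∀ i, 1 ≤ W.d i) (h : L.HasRoom H) (j : Fin K) :
    (L.d0 j : ℤ) ≤ L.Me j := by
  obtain ⟨-, -, A, -, -, -, hA, -, -⟩ := h
  have h1 := (A j).rank_le_width
  have : W.d j ≤ L.d0 j := Nat.le_add_right _ _
  have := hd j
  rw [hA j] at h1
  omega

theorem Feasible.sum_constraints_le (hd : ∀ i, 1 ≤ W.d i) (h : L.Feasible)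
    (Ωsub : Finset (Fin K × Fin K)) (hΩ : Ωsub ⊆ L.linksIV) :
    ∑ p ∈ Ωsub, L.constraints p.1 p.2 ≤
      ∑ j ∈ Ωsub.image Prod.fst, L.freeU j + ∑ i ∈ Ωsub.image Prod.snd, L.freeV i := by
  obtain ⟨s, hsm, hpos, hs⟩ := h.hasRoom hd
  obtain ⟨H, hH⟩ := nonempty_of_measure_ne_zero
    (Network.channelLaw_resampleSet_pos (L.links .IV) hsm hpos).ne'
  have h2 : ∀ H' : W.Channels, ∀ j, ∀ i ∈ L.Ω .II j,
      Network.resample (L.links .IV) H H' j i = H j i := fun H' j i =>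
    resample_links_of_ne (by simp)
  have h3 : ∀ H' : W.Channels, ∀ j, ∀ i ∈ L.Ω .III j,
      Network.resample (L.links .IV) H H' j i = H j i := fun H' j i =>
    resample_links_of_ne (by simp)
  obtain ⟨H₀, hH₀⟩ : {H' | Network.resample (L.links .IV) H H' ∈ s}.Nonempty :=
    nonempty_of_measure_ne_zero (ne_of_gt hH)
  have hroom := hs _ hH₀
  obtain ⟨S, T, -, -, hS₀, hT₀, -⟩ := hs _ hH₀
  have hS := hS₀.congr (h2 H₀)
  have hT := hT₀.congr (h3 H₀)
  have hsum := sum_le_of_channelLaw_pos (W := W) (Ωsub.image Prod.fst) (Ωsub.image Prod.snd) Ωsub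
    Finset.subset_product L.d0 (fun j => (L.Me j).toNat) W.d (fun i => (L.Ne i).toNat)
    (fun j => (padRows (W.M j) (S j))ᴴ) (fun i => padRows (W.N i) (T i))
    (fun j _ => rank_conjTranspose_padRows (L.Ms_le j) (hS j).1)
    (fun i _ => rank_padRows (L.Ns_le i) (hT i).1)
    (s := {H' | Network.resample (L.links .IV) H H' ∈ s}) hH ?_
  · refine hsum.trans_eq ?_
    simp only [freeU, freeV]
    congr 1
    · refine Finset.sum_congr rfl fun j _ => ?_
      rw [Int.toNat_of_nonneg ((Int.natCast_nonneg _).trans (hroom.le_Me hd j))]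
    · refine Finset.sum_congr rfl fun i _ => ?_
      rw [Int.toNat_of_nonneg ((Int.natCast_nonneg _).trans (hroom.le_Ne hd i))]
  · intro H' hH'
    obtain ⟨S', T', A, Va, hS', hT', hA, hV, hz⟩ := hs _ hH'
    have hS'' := hS'.congr (h2 H')
    have hT'' := hT'.congr (h3 H')
    choose X hX using hS.exists_eq_mul hS''
    choose Y hY using hT.exists_eq_mul hS hS'' hT''
    refine ⟨fun j => A j * (X j)ᴴ, fun i => Y i * Va i, fun j _ => ?_, fun i _ => ?_, ?_⟩
    · refine eq_of_rank_mul_eq_left (B := (S j)ᴴ * S' j)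
        ((congrArg Matrix.rank ?_).trans (hA j))
      calc A j * (X j)ᴴ * ((S j)ᴴ * S' j) = A j * ((S j * X j)ᴴ * S' j) := by
            simp only [Matrix.conjTranspose_mul, Matrix.mul_assoc]
        _ = A j := by rw [← hX j, (hS' j).1, Matrix.mul_one]
    · refine eq_of_rank_mul_eq_right (A := (T' i)ᴴ * T i)
        ((congrArg Matrix.rank ?_).trans (hV i))
      calc (T' i)ᴴ * T i * (Y i * Va i) = (T' i)ᴴ * (T i * Y i) * Va i := by
            simp only [Matrix.mul_assoc]
        _ = Va i := by rw [← hY i, (hT' i).1, Matrix.one_mul]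
    · rintro ⟨j, i⟩ hp
      have hi : i ∈ L.Ω .IV j := by simpa [linksIV] using hΩ hp
      have h0 := hz j i hi
      have hf : L.sub (Network.resample (L.links .IV) H H') j i = L.sub H' j i :=
        sub_congr (Network.resample_of_mem H H' (show (j, i) ∈ L.links .IV from hi))
      rw [hf, hX, hY] at h0
      rw [padRows_mul_fading_mul_padRows, ← h0, Matrix.conjTranspose_mul]
      simp only [Matrix.mul_assoc]

end FeedbackProfile

end InterferenceAlignment

theorem theorem1 {K : ℕ} (W : InterferenceAlignment.Network K)
    (hd : ∀ i, 1 ≤ W.d i)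
    (L : InterferenceAlignment.FeedbackProfile W)
    (hfeas : L.Feasible) :
    (∀ i, (W.d i : ℤ) ≤ L.Ne i) ∧
    (∀ j, (L.d0 j : ℤ) ≤ L.Me j) ∧
    (∀ Ωsub : Finset (Fin K × Fin K), Ωsub ⊆ L.linksIV →
      ∑ p ∈ Ωsub, L.constraints p.1 p.2 ≤
        ∑ j ∈ Ωsub.image Prod.fst, L.freeU j + ∑ i ∈ Ωsub.image Prod.snd, L.freeV i) := by
  obtain ⟨s, -, hpos, hs⟩ := hfeas.hasRoom hd
  obtain ⟨H, hH⟩ := nonempty_of_measure_ne_zero hpos.ne'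
  exact ⟨(hs H hH).le_Ne hd, (hs H hH).le_Me hd, hfeas.sum_constraints_le hd⟩
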